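/- Let $(W_{ij})_{(i,j)\in\mathbb N^2}$ be an infinite array of random vectors in $\mathbb R^d$ that is separately exchangeable, i.e. $(W_{ij})_{i,j}\overset{d}{=}(W_{\pi_1(i)\pi_2(j)})_{i,j}$ for all permutations $\pi_1,\pi_2$ of $\mathbb N$, and dissociated, i.e. for all $c_1,c_2\in\mathbb N$ the block $(W_{ij})_{i\le c_1,\,j\le c_2}$ is independent of $(W_{ij})_{i>c_1,\,j>c_2}$. Let $\mathcal F$ be a class of measurable functions $f:\mathbb R^d\to\mathbb R$ such that: (a) $\mathcal F$ has an envelope $F$ (that is, $|f(w)|\le F(w)$ for all $f\in\mathcal F$ and $w\in\mathbb R^d$) with $E[F(W_{11})]<\infty$ and, for every $\varepsilon>0$, $\sup_Q N(\mathcal F,\|\cdot\|_{Q,2},\varepsilon\|F\|_{Q,2})<\infty$, where the supremum is over all finite measures $Q$ carried by a finite set, $\|f\|_{Q,2}=(\int f^2\,dQ)^{1/2}$, and $N(T,d,r)$ is the least cardinality of a set $T_r\subseteq T$ such that every $t\in T$ has some $s\in T_r$ with $d(t,s)\le r$; (b) $\mathcal F$ is pointwise measurable: there is a countable $\mathcal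 G\subseteq\mathcal F$ such that every $f\in\mathcal F$ is the pointwise limit of a sequence in $\mathcal G$. For each $(N,M)$ let $p_{NM}\in[0,1]$ and let $Z_{ij}=Z_{ij}^{(N,M)}$, $1\le i\le N$, $1\le j\le M$, be i.i.d. Bernoulli$(p_{NM})$ random variables independent of the data $(W_{ij})_{i\le N,\,j\le M}$; put $\hat L=\sum_{i=1}^N\sum_{j=1}^M Z_{ij}$, and assume that the expected subsample size $NMp_{NM}$ tends to infinity as $\min\{N,M\}\to\infty$. Then, as $\min\{N,M\}\to\infty$, $$\sup_{f\in\mathcal F}\left|\frac1{\hat L}\sum_{i=1}^N\sum_{j=1}^M Z_{ij}f(W_{ij})-E[f(W_{11})]\right|\overset{P}{\longrightarrow}0 .$$ -/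

import Mathlib

open MeasureTheory ProbabilityTheory Filter Topology
open scoped ENNReal

/-- The array `(W i j)` is separately exchangeable: for all permutations `π₁`, `π₂` of the two index
sets, `(W i j)` and `(W (π₁ i) (π₂ j))` have the same joint law.  Indices start at `0`. -/
def SeparatelyExchangeable {Ω S : Type*} [MeasurableSpace Ω] [MeasurableSpace S]
    (P : Measure Ω) (W : ℕ → ℕ → Ω → S) : Prop :=
  ∀ π₁ π₂ : Equiv.Perm ℕ,
    IdentDistrib (fun ω (ij : ℕ × ℕ) => W ij.1 ij.2 ω)
      (fun ω (ij : ℕ × ℕ) => W (π₁ ij.1) (π₂ ij.2) ω) P P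

/-- The array `(W i j)` is dissociated: for all `c₁`, `c₂`, the block formed by the first `c₁` rows
and first `c₂` columns is independent of the block formed by the remaining rows and the remaining
columns. -/
def Dissociated {Ω S : Type*} [MeasurableSpace Ω] [MeasurableSpace S]
    (P : Measure Ω) (W : ℕ → ℕ → Ω → S) : Prop :=
  ∀ c₁ c₂ : ℕ,
    IndepFun (fun ω (ij : {ij : ℕ × ℕ // ij.1 < c₁ ∧ ij.2 < c₂}) => W ij.1.1 ij.1.2 ω)
      (fun ω (ij : {ij : ℕ × ℕ // c₁ ≤ ij.1 ∧ c₂ ≤ ij.2}) => W ij.1.1 ij.1.2 ω) P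

/-- `N` is an `r`-net of `T` for the (extended) pseudometric `d`: a subset of `T` such that every
point of `T` is within distance `r` of a point of `N`. -/
def IsNetOf {α : Type*} (T : Set α) (d : α → α → ℝ≥0∞) (r : ℝ≥0∞) (N : Set α) : Prop :=
  N ⊆ T ∧ ∀ t ∈ T, ∃ s ∈ N, d t s ≤ r

/-- The covering number `N(T, d, r)`: the least cardinality of an `r`-net of `T`
(`⊤` if there is no finite one). -/
noncomputable def coveringNum {α : Type*} (T : Set α) (d : α → α → ℝ≥0∞) (r : ℝ≥0∞) : ℕ∞ :=
  ⨅ (N : Set α) (_ : IsNetOf T d r N), N.encard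

/-- `Q` is a finite discrete measure: of finite total mass, and carried by a finite set. -/
def IsFiniteDiscrete {S : Type*} [MeasurableSpace S] (Q : Measure S) : Prop :=
  IsFiniteMeasure Q ∧ ∃ s : Finset S, Q (↑s)ᶜ = 0

/-- The `L²(Q)` distance `‖f - g‖_{Q,2}`. -/
noncomputable def l2Dist {S : Type*} [MeasurableSpace S] (Q : Measure S) (f g : S → ℝ) : ℝ≥0∞ :=
  eLpNorm (f - g) 2 Q

/-- `F` is an envelope of the class `𝓕`. -/
def IsEnvelope {S : Type*} (𝓕 : Set (S → ℝ)) (F : S → ℝ) : Prop :=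
  ∀ f ∈ 𝓕, ∀ s, |f s| ≤ F s

/-- For every `ε > 0`, `sup_Q N(𝓕, ‖·‖_{Q,2}, ε ‖F‖_{Q,2}) < ∞`, the supremum being over all finite
discrete measures `Q`. -/
def FiniteUniformCovering {S : Type*} [MeasurableSpace S] (𝓕 : Set (S → ℝ)) (F : S → ℝ) : Prop :=
  ∀ ε : ℝ, 0 < ε →
    (⨆ (Q : Measure S) (_ : IsFiniteDiscrete Q),
      coveringNum 𝓕 (l2Dist Q) (ENNReal.ofReal ε * eLpNorm F 2 Q)) < ⊤

/-- `𝓕` is a pointwise measurable class: a class of measurable functions with a countable subclass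
`𝓖` such that each member of `𝓕` is the pointwise limit of a sequence in `𝓖`. -/
def PointwiseMeasurable {S : Type*} [MeasurableSpace S] (𝓕 : Set (S → ℝ)) : Prop :=
  (∀ f ∈ 𝓕, Measurable f) ∧
    ∃ 𝓖 ⊆ 𝓕, 𝓖.Countable ∧ ∀ f ∈ 𝓕, ∃ g : ℕ → S → ℝ,
      (∀ m, g m ∈ 𝓖) ∧ ∀ s, Tendsto (fun m => g m s) atTop (𝓝 (f s))

/-- `(Z i j)`, `i < N`, `j < M`, are i.i.d. Bernoulli(`p`) random variables (with values `0`, `1`),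
independent of the data `(W i j)`, `i < N`, `j < M`. -/
structure IsBernoulliSelection {Ω S : Type*} [MeasurableSpace Ω] [MeasurableSpace S]
    (P : Measure Ω) (W : ℕ → ℕ → Ω → S) (N M : ℕ) (p : unitInterval)
    (Z : Fin N → Fin M → Ω → ℝ) : Prop where
  hasLaw : ∀ i j, HasLaw (Z i j) (bernoulliMeasure 1 0 p) P
  iIndep : iIndepFun (fun ij : Fin N × Fin M => Z ij.1 ij.2) P
  indep_data : IndepFun (fun ω (ij : Fin N × Fin M) => Z ij.1 ij.2 ω)
    (fun ω (ij : Fin N × Fin M) => W ij.1 ij.2 ω) P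

/-- The size `L̂ = ∑ᵢ ∑ⱼ Z i j` of the selected subsample. -/
noncomputable def subsampleSize {Ω : Type*} {N M : ℕ} (Z : Fin N → Fin M → Ω → ℝ) (ω : Ω) : ℝ :=
  ∑ i, ∑ j, Z i j ω

/-- The subsample mean `L̂⁻¹ ∑ᵢ ∑ⱼ Z i j * f (W i j)`. -/
noncomputable def subsampleMean {Ω S : Type*} (W : ℕ → ℕ → Ω → S) {N M : ℕ}
    (Z : Fin N → Fin M → Ω → ℝ) (f : S → ℝ) (ω : Ω) : ℝ :=
  1 / subsampleSize Z ω * ∑ i, ∑ j, Z i j ω * f (W i j ω)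

/-! Write `n = NMp` and `e = E f(W₁₁)`. Then `L̂ · (mean - e) = ∑ (Z - p) f(W) + p ∑ (f(W) - e) - e
∑ (Z - p)`. It suffices that the expected supremum of each term be at most a small multiple of `n`:
Markov's inequality then controls all three, and off the event `|L̂ - n| > n/2` one may divide by
`L̂ ≥ n/2`.

All three bounds rest on one estimate for weighted Rademacher sums, `exists_rademacher_bound`.
Points where the envelope is large cost only a small tail of `F`. On the rest, the class is replaced
by an `L²(Q)`-net for the discrete measure `Q` with weights `z i` at `w i`. The net has at most `c`
elements whatever `Q` is, so summing second-moment bounds over it costs a constant factor on an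
error of order `√n`.

In the first term, given `W`, the summands are independent through `Z`, and symmetrization applies
(`lintegral_iSup_sampling_le`). The dependence inside the array plays no role, since only the common
marginal law enters. The third term is the same statement for the class `{1}`.

In the second term, the full sum is an average over shifted diagonals of length `min N M`
(`lintegral_iSup_array_le`). Exchangeability gives every shifted diagonal the law of the main one,
and dissociation makes that one i.i.d., so the classical uniform law of large numbers applies
(`lintegral_iSup_iid_le`). -/

/-! ### Rademacher sums -/

/-- The sign `±1` encoded by a Boolean. -/
noncomputable def boolSign (b : Bool) : ℝ := if b then 1 else -1

theorem boolSign_sq (b : Bool) : boolSign b * boolSign b = 1 := by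
  cases b <;> simp [boolSign]

theorem boolSign_not (b : Bool) : boolSign (!b) = -boolSign b := by
  cases b <;> simp [boolSign]

theorem enorm_boolSign (b : Bool) : ‖boolSign b‖ₑ = 1 := by
  cases b <;> simp [boolSign]

/-- Orthogonality of the signs: for `i ≠ j`, flipping `ε i` is an involution that negates the
product. -/
theorem sum_boolSign_mul {ι : Type*} [Fintype ι] [DecidableEq ι] (i j : ι) :
    ∑ ε : ι → Bool, boolSign (ε i) * boolSign (ε j)
      = if i = j then (Fintype.card (ι → Bool) : ℝ) else 0 := by
  split_ifs with h
  · subst h; simp [boolSign_sq]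
  · have hinv : Function.Involutive
        (fun ε : ι → Bool => Function.update ε i (!(ε i))) := by
      intro ε
      ext k
      by_cases hk : k = i
      · subst hk; simp
      · simp [hk]
    have := Fintype.sum_equiv hinv.toPerm
      (fun ε : ι → Bool => boolSign (ε i) * boolSign (ε j))
      (fun ε : ι → Bool => -(boolSign (ε i) * boolSign (ε j))) (by
        intro ε
        simp [Function.Involutive.coe_toPerm, Function.update_of_ne (Ne.symm h), boolSign_not])
    rw [Finset.sum_neg_distrib] at this
    linarith

/-- The second moment of a Rademacher sum. -/
theorem sum_sq_boolSign_sum {ι : Type*} [Fintype ι] [DecidableEq ι] (a : ι → ℝ) :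
    ∑ ε : ι → Bool, (∑ i, boolSign (ε i) * a i) ^ 2
      = Fintype.card (ι → Bool) * ∑ i, a i ^ 2 := by
  have h1 (ε : ι → Bool) : (∑ i, boolSign (ε i) * a i) ^ 2
      = ∑ i, ∑ j, (boolSign (ε i) * boolSign (ε j)) * (a i * a j) := by
    rw [sq, Finset.sum_mul_sum]
    refine Finset.sum_congr rfl fun i _ => Finset.sum_congr rfl fun j _ => by ring
  simp_rw [h1]
  rw [Finset.sum_comm, Finset.mul_sum]
  refine Finset.sum_congr rfl fun i _ => ?_
  rw [Finset.sum_comm]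
  simp_rw [← Finset.sum_mul, sum_boolSign_mul]
  simp [sq]

/-- Passes from second to first moments without square roots; the free parameter `s` is tuned at
each use. -/
theorem abs_le_sq_div_add {s : ℝ} (hs : 0 < s) (x : ℝ) : |x| ≤ x ^ 2 / s + s := by
  rw [← sq_abs, div_add' _ _ _ hs.ne', le_div_iff₀ hs]
  nlinarith [sq_nonneg (|x| - s), abs_nonneg x, mul_nonneg (abs_nonneg x) hs.le]

theorem sum_abs_boolSign_sum_le {ι : Type*} [Fintype ι] [DecidableEq ι] (a : ι → ℝ) {s : ℝ} (hs : 0 < s) :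
    ∑ ε : ι → Bool, |∑ i, boolSign (ε i) * a i|
      ≤ Fintype.card (ι → Bool) * ((∑ i, a i ^ 2) / s + s) := by
  calc _ ≤ ∑ ε : ι → Bool, ((∑ i, boolSign (ε i) * a i) ^ 2 / s + s) :=
        Finset.sum_le_sum fun ε _ => abs_le_sq_div_add hs _
    _ = _ := by
      rw [Finset.sum_add_distrib, ← Finset.sum_div, sum_sq_boolSign_sum]
      simp only [Finset.sum_const, Finset.card_univ, nsmul_eq_mul]
      ring

/-! ### Nets for weighted empirical measures -/

/-- The bound `c` precedes `Q`: the net may depend on the sample, its size does not. -/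
theorem FiniteUniformCovering.exists_net {S : Type*} [MeasurableSpace S] {𝓕 : Set (S → ℝ)}
    {F : S → ℝ} (h : FiniteUniformCovering 𝓕 F) {η : ℝ} (hη : 0 < η) :
    ∃ c : ℕ, ∀ Q : Measure S, IsFiniteDiscrete Q → ∃ T : Finset (S → ℝ), T.card ≤ c ∧
      IsNetOf 𝓕 (l2Dist Q) (ENNReal.ofReal η * eLpNorm F 2 Q) (T : Set (S → ℝ)) := by
  obtain ⟨c, hc⟩ := ENat.ne_top_iff_exists.mp (h η hη).ne
  refine ⟨c, fun Q hQ => ?_⟩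
  have hle : coveringNum 𝓕 (l2Dist Q) (ENNReal.ofReal η * eLpNorm F 2 Q) < (c : ℕ∞) + 1 := by
    refine lt_of_le_of_lt ?_ ((ENat.lt_add_one_iff (ENat.natCast_ne_top c)).2 le_rfl)
    rw [hc]
    exact le_iSup₂_of_le Q hQ le_rfl
  simp only [coveringNum, iInf_lt_iff] at hle
  obtain ⟨T, hT, hcard⟩ := hle
  have hcard' := (ENat.lt_add_one_iff (ENat.natCast_ne_top c)).1 hcard
  have hfin : T.Finite := Set.finite_of_encard_le_coe hcard'
  refine ⟨hfin.toFinset, ?_, by simpa using hT⟩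
  rw [hfin.encard_eq_coe_toFinset_card] at hcard'
  exact_mod_cast hcard'

/-- The measure with weight `z i` at `w i`. -/
noncomputable def weightedDirac {ι S : Type*} [Fintype ι] [MeasurableSpace S] (w : ι → S)
    (z : ι → ℝ) : Measure S :=
  ∑ i, ENNReal.ofReal (z i) • Measure.dirac (w i)

theorem lintegral_weightedDirac {ι S : Type*} [Fintype ι] [MeasurableSpace S]
    [MeasurableSingletonClass S] (w : ι → S) (z : ι → ℝ) (f : S → ℝ≥0∞) :
    ∫⁻ x, f x ∂(weightedDirac w z) = ∑ i, ENNReal.ofReal (z i) * f (w i) := by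
  simp [weightedDirac]

theorem isFiniteDiscrete_weightedDirac {ι S : Type*} [Fintype ι] [MeasurableSpace S]
    [MeasurableSingletonClass S] (w : ι → S) (z : ι → ℝ) :
    IsFiniteDiscrete (weightedDirac w z) := by
  classical
  refine ⟨⟨?_⟩, Finset.univ.image w, ?_⟩
  · rw [← lintegral_one, lintegral_weightedDirac]
    simp [ENNReal.sum_lt_top]
  · rw [← lintegral_indicator_one (Finset.measurableSet _).compl, lintegral_weightedDirac]
    simp

/-- The squared `L²` norm of a weighted empirical measure is a finite sum, so squaring the net
condition gives a real inequality. -/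
theorem sum_weight_sq_le_of_eLpNorm_le {ι S : Type*} [Fintype ι] [MeasurableSpace S]
    [MeasurableSingletonClass S] {w : ι → S} {z : ι → ℝ} (hz : ∀ i, 0 ≤ z i) {f F : S → ℝ} {η : ℝ}
    (hη : 0 ≤ η)
    (h : eLpNorm f 2 (weightedDirac w z) ≤ ENNReal.ofReal η * eLpNorm F 2 (weightedDirac w z)) :
    ∑ i, z i * f (w i) ^ 2 ≤ η ^ 2 * ∑ i, z i * F (w i) ^ 2 := by
  have key (f : S → ℝ) : eLpNorm f 2 (weightedDirac w z) ^ 2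
      = ENNReal.ofReal (∑ i, z i * f (w i) ^ 2) := by
    rw [eLpNorm_eq_lintegral_rpow_enorm_toReal (by norm_num) (by norm_num),
      lintegral_weightedDirac, ← ENNReal.rpow_natCast, ← ENNReal.rpow_mul]
    simp only [ENNReal.toReal_ofNat, Nat.cast_ofNat, one_div]
    rw [inv_mul_cancel₀ (by norm_num), ENNReal.rpow_one,
      ENNReal.ofReal_sum_of_nonneg fun i _ => mul_nonneg (hz i) (sq_nonneg _)]
    refine Finset.sum_congr rfl fun i _ => ?_
    rw [ENNReal.ofReal_mul (hz i), ← sq_abs, ENNReal.ofReal_pow (abs_nonneg _),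
      Real.enorm_eq_ofReal_abs]
    norm_cast
  have h2 := pow_le_pow_left₀ zero_le h 2
  rw [mul_pow, key, key, ← ENNReal.ofReal_pow hη, ← ENNReal.ofReal_mul (by positivity)] at h2
  exact (ENNReal.ofReal_le_ofReal_iff (mul_nonneg (by positivity)
    (Finset.sum_nonneg fun i _ => mul_nonneg (hz i) (sq_nonneg _)))).1 h2

/-! ### Maximal inequality for Rademacher processes -/

/-- Maximal inequality for a weighted Rademacher process indexed by a class with small nets;
the points outside `A`, where the envelope may be large, are bounded trivially. -/
theorem sum_boolSign_iSup_le {ι S : Type*} [Fintype ι] [DecidableEq ι] [MeasurableSpace S]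
    [MeasurableSingletonClass S] {𝓕 : Set (S → ℝ)} {F : S → ℝ} (henv : IsEnvelope 𝓕 F)
    {η : ℝ} (hη : 0 < η) {c : ℕ}
    (hnet : ∀ Q : Measure S, IsFiniteDiscrete Q → ∃ T : Finset (S → ℝ), T.card ≤ c ∧
      IsNetOf 𝓕 (l2Dist Q) (ENNReal.ofReal η * eLpNorm F 2 Q) (T : Set (S → ℝ)))
    {A : Set S} {K : ℝ} (hK : 0 < K) (hA : ∀ x ∈ A, F x ≤ K)
    {𝓖 : Set (S → ℝ)} (h𝓖 : 𝓖 ⊆ 𝓕) {D : S → ℝ≥0∞} (hD : ∀ g ∈ 𝓖, ∀ x, ‖g x‖ₑ ≤ D x)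
    {s : ℝ} (hs : 0 < s) (w : ι → S) (z : ι → ℝ) (hz0 : ∀ i, 0 ≤ z i) (hz1 : ∀ i, z i ≤ 1) :
    ∑ ε : ι → Bool, ⨆ g : 𝓖, ‖∑ i, boolSign (ε i) * (z i * g.1 (w i))‖ₑ
      ≤ Fintype.card (ι → Bool) * (ENNReal.ofReal ((2 * η * K + c * K ^ 2 / s) * ∑ i, z i + c * s)
        + ∑ i, ENNReal.ofReal (z i) * Aᶜ.indicator D (w i)) := by
  -- The net is taken for the weights cut off outside `A`, so that `‖F‖` is controlled by `K`.
  set y : ι → ℝ := fun i => A.indicator (fun _ => z i) (w i) with hy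
  have hy0 (i : ι) : 0 ≤ y i := Set.indicator_nonneg (fun _ _ => hz0 i) _
  have hyz (i : ι) : y i ≤ z i := Set.indicator_le_self' (fun _ _ => hz0 i) _
  obtain ⟨T, hTc, hTsub, hT⟩ := hnet _ (isFiniteDiscrete_weightedDirac w y)
  have hyK (f : S → ℝ) (hf : ∀ x, |f x| ≤ F x) : ∑ i, y i * f (w i) ^ 2 ≤ K ^ 2 * ∑ i, z i := by
    rw [Finset.mul_sum]
    refine Finset.sum_le_sum fun i _ => ?_
    by_cases hi : w i ∈ A
    · have h1 : f (w i) ^ 2 ≤ K ^ 2 := sq_le_sq' (by linarith [abs_le.1 (hf (w i)), hA _ hi])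
        (by linarith [abs_le.1 (hf (w i)), hA _ hi])
      nlinarith [hy0 i, hyz i, hz0 i, sq_nonneg K]
    · simp only [hy, Set.indicator_of_notMem hi, zero_mul]
      exact mul_nonneg (sq_nonneg _) (hz0 i)
  have hFnn (x : S) (hne : 𝓕.Nonempty) : |F x| ≤ F x := by
    obtain ⟨f, hf⟩ := hne
    rw [abs_of_nonneg ((abs_nonneg _).trans (henv f hf x))]
  set B : ℝ := 2 * η * K * ∑ i, z i with hB
  have hzs : 0 ≤ ∑ i, z i := Finset.sum_nonneg fun i _ => hz0 i
  have hB0 : 0 ≤ B := by positivity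
  have happrox (f : S → ℝ) (hf : f ∈ 𝓕) : ∃ g ∈ T, ∑ i, y i * |f (w i) - g (w i)| ≤ B := by
    obtain ⟨g, hg, hd⟩ := hT f hf
    refine ⟨g, hg, ?_⟩
    have h1 := sum_weight_sq_le_of_eLpNorm_le hy0 hη.le hd
    have h2 := hyK F (fun x => hFnn x ⟨f, hf⟩)
    -- The parameter `s = η * K` balances the two terms: each contributes `η * K * ∑ z i`.
    have hηK : 0 < η * K := by positivity
    calc ∑ i, y i * |f (w i) - g (w i)|
        ≤ ∑ i, y i * ((f (w i) - g (w i)) ^ 2 / (η * K) + η * K) :=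
          Finset.sum_le_sum fun i _ => mul_le_mul_of_nonneg_left (abs_le_sq_div_add hηK _) (hy0 i)
      _ = (∑ i, y i * (f (w i) - g (w i)) ^ 2) / (η * K) + η * K * ∑ i, y i := by
          rw [Finset.sum_div, Finset.mul_sum, ← Finset.sum_add_distrib]
          exact Finset.sum_congr rfl fun i _ => by ring
      _ ≤ (η ^ 2 * (K ^ 2 * ∑ i, z i)) / (η * K) + η * K * ∑ i, z i := by
          gcongr with i
          · exact h1.trans (by gcongr)
          · exact hyz i
      _ = B := by rw [hB]; field_simp; ring
  -- Three sources: the nearby net element, the approximation error on `A`, and the points outside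
  -- `A`. The maximum over the net is bounded by the sum over it.
  have hpt (ε : ι → Bool) : ⨆ g : 𝓖, ‖∑ i, boolSign (ε i) * (z i * g.1 (w i))‖ₑ
      ≤ ENNReal.ofReal (∑ g ∈ T, |∑ i, boolSign (ε i) * (y i * g (w i))|)
        + (ENNReal.ofReal B + ∑ i, ENNReal.ofReal (z i) * Aᶜ.indicator D (w i)) := by
    refine iSup_le fun ⟨f, hf⟩ => ?_
    obtain ⟨g, hg, hfg⟩ := happrox f (h𝓖 hf)
    have hsplit : ∑ i, boolSign (ε i) * (z i * f (w i))
        = ∑ i, boolSign (ε i) * (y i * g (w i))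
          + (∑ i, boolSign (ε i) * (y i * (f (w i) - g (w i)))
          + ∑ i, boolSign (ε i) * ((z i - y i) * f (w i))) := by
      simp only [← Finset.sum_add_distrib]
      exact Finset.sum_congr rfl fun i _ => by ring
    dsimp only
    rw [hsplit]
    refine (enorm_add_le _ _).trans (add_le_add ?_ ((enorm_add_le _ _).trans (add_le_add ?_ ?_)))
    · rw [Real.enorm_eq_ofReal_abs]
      exact ENNReal.ofReal_le_ofReal (Finset.single_le_sum
        (f := fun g : S → ℝ => |∑ i, boolSign (ε i) * (y i * g (w i))|)
        (fun _ _ => abs_nonneg _) hg)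
    · rw [Real.enorm_eq_ofReal_abs]
      refine ENNReal.ofReal_le_ofReal (le_trans (Finset.abs_sum_le_sum_abs _ _) ?_)
      refine le_trans (le_of_eq (Finset.sum_congr rfl fun i _ => ?_)) hfg
      rw [abs_mul, abs_mul, abs_of_nonneg (hy0 i)]
      cases ε i <;> simp [boolSign]
    · refine (enorm_sum_le _ _).trans (Finset.sum_le_sum fun i _ => ?_)
      rw [enorm_mul, enorm_mul, enorm_boolSign, one_mul]
      by_cases hi : w i ∈ A
      · simp [hy, hi]
      · simp only [hy, Set.indicator_of_notMem hi, sub_zero,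
          Set.indicator_of_mem (Set.mem_compl hi)]
        rw [Real.enorm_eq_ofReal (hz0 i)]
        gcongr
        exact hD f hf _
  have hTsum : ∑ ε : ι → Bool, ∑ g ∈ T, |∑ i, boolSign (ε i) * (y i * g (w i))|
      ≤ Fintype.card (ι → Bool) * (c * (K ^ 2 * (∑ i, z i) / s + s)) := by
    rw [Finset.sum_comm]
    have hnn : 0 ≤ K ^ 2 * (∑ i, z i) / s + s := by positivity
    calc _ ≤ ∑ g ∈ T, (Fintype.card (ι → Bool) * (K ^ 2 * (∑ i, z i) / s + s) : ℝ) := by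
          refine Finset.sum_le_sum fun g hg => (sum_abs_boolSign_sum_le _ hs).trans ?_
          gcongr
          refine le_trans (Finset.sum_le_sum fun i _ => ?_) (hyK g (henv g (hTsub hg)))
          rw [mul_pow]
          -- Since `0 ≤ y i ≤ z i ≤ 1`, one has `y i ^ 2 ≤ y i`.
          exact mul_le_mul_of_nonneg_right
            (by nlinarith [hy0 i, hyz i, hz1 i]) (sq_nonneg _)
      _ = T.card * (Fintype.card (ι → Bool) * (K ^ 2 * (∑ i, z i) / s + s) : ℝ) := by
          rw [Finset.sum_const, nsmul_eq_mul]
      _ ≤ c * (Fintype.card (ι → Bool) * (K ^ 2 * (∑ i, z i) / s + s) : ℝ) := by gcongr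
      _ = _ := by ring
  calc _ ≤ ∑ ε : ι → Bool, _ := Finset.sum_le_sum fun ε _ => hpt ε
    _ = ENNReal.ofReal (∑ ε : ι → Bool, ∑ g ∈ T, |∑ i, boolSign (ε i) * (y i * g (w i))|)
        + Fintype.card (ι → Bool) *
          (ENNReal.ofReal B + ∑ i, ENNReal.ofReal (z i) * Aᶜ.indicator D (w i)) := by
        rw [Finset.sum_add_distrib, ENNReal.ofReal_sum_of_nonneg
          (fun ε _ => Finset.sum_nonneg fun _ _ => abs_nonneg _)]
        simp only [Finset.sum_const, Finset.card_univ, nsmul_eq_mul]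
    _ ≤ ENNReal.ofReal (Fintype.card (ι → Bool) * (c * (K ^ 2 * (∑ i, z i) / s + s)))
        + Fintype.card (ι → Bool) *
          (ENNReal.ofReal B + ∑ i, ENNReal.ofReal (z i) * Aᶜ.indicator D (w i)) := by
        gcongr
    _ = _ := by
        rw [ENNReal.ofReal_mul (by positivity), ENNReal.ofReal_natCast, ← mul_add, ← add_assoc,
          ← ENNReal.ofReal_add (by positivity) hB0]
        congr 3
        rw [hB]; ring

/-! ### Symmetrization -/

/-- The mean is an integral over an independent copy `y`, which can then be taken outside the norm.
-/
theorem enorm_sum_sub_integral_le {ι S : Type*} [Fintype ι] [MeasurableSpace S] (μ : Measure S)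
    [IsProbabilityMeasure μ] (h : ι → S → ℝ) (hint : ∀ i, Integrable (h i) μ) (x : ι → S) :
    ‖∑ i, (h i (x i) - ∫ s, h i s ∂μ)‖ₑ
      ≤ ∫⁻ y, ‖∑ i, (h i (x i) - h i (y i))‖ₑ ∂(Measure.pi fun _ : ι => μ) := by
  have hp (i : ι) : MeasurePreserving (fun y : ι → S => y i) (Measure.pi fun _ : ι => μ) μ :=
    measurePreserving_eval (fun _ : ι => μ) i
  have hi (i : ι) : Integrable (fun y : ι → S => h i (y i)) (Measure.pi fun _ : ι => μ) :=
    (hp i).integrable_comp_of_integrable (hint i)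
  have hv (i : ι) : ∫ y : ι → S, h i (y i) ∂(Measure.pi fun _ : ι => μ) = ∫ s, h i s ∂μ := by
    have := integral_map (hp i).aemeasurable (f := h i)
      (by rw [(hp i).map_eq]; exact (hint i).aestronglyMeasurable)
    rw [(hp i).map_eq] at this
    exact this.symm
  have heq : ∑ i, (h i (x i) - ∫ s, h i s ∂μ)
      = ∫ y, ∑ i, (h i (x i) - h i (y i)) ∂(Measure.pi fun _ : ι => μ) := by
    rw [integral_finsetSum (f := fun i (y : ι → S) => h i (x i) - h i (y i)) _
      fun i _ => (integrable_const _).sub (hi i)]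
    refine Finset.sum_congr rfl fun i _ => ?_
    rw [integral_sub (integrable_const _) (hi i), hv i]
    simp
  rw [heq]
  exact enorm_integral_le_lintegral_enorm _

/-- Symmetrization for a fixed choice of signs. -/
theorem lintegral_iSup_sub_integral_le_of_signs {ι S T : Type*} [Fintype ι] [Countable T]
    [MeasurableSpace S] (μ : Measure S) [IsProbabilityMeasure μ] (h : T → ι → S → ℝ)
    (hm : ∀ t i, Measurable (h t i)) (hint : ∀ t i, Integrable (h t i) μ) (ε : ι → Bool) :
    ∫⁻ x, ⨆ t, ‖∑ i, (h t i (x i) - ∫ s, h t i s ∂μ)‖ₑ ∂(Measure.pi fun _ : ι => μ)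
      ≤ 2 * ∫⁻ x, ⨆ t, ‖∑ i, boolSign (ε i) * h t i (x i)‖ₑ ∂(Measure.pi fun _ : ι => μ) := by
  set π : Measure (ι → S) := Measure.pi fun _ : ι => μ with hπ
  set R : (ι → S) → ℝ≥0∞ := fun x => ⨆ t, ‖∑ i, boolSign (ε i) * h t i (x i)‖ₑ with hR
  have hRm : Measurable R := by
    refine Measurable.iSup fun t => Measurable.enorm (Finset.measurable_sum _ fun i _ => ?_)
    exact ((hm t i).comp (measurable_pi_apply i)).const_mul _
  set G : (ι → S) × (ι → S) → ℝ≥0∞ :=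
    fun q => ⨆ t, ‖∑ i, (h t i (q.1 i) - h t i (q.2 i))‖ₑ with hG
  have hGm : Measurable G := by
    refine Measurable.iSup fun t => Measurable.enorm (Finset.measurable_sum _ fun i _ => ?_)
    exact ((hm t i).comp ((measurable_pi_apply i).comp measurable_fst)).sub
      ((hm t i).comp ((measurable_pi_apply i).comp measurable_snd))
  have harrow := measurePreserving_arrowProdEquivProdArrow S S ι (fun _ => μ) (fun _ => μ)
  -- Exchanging a point with its copy wherever the sign is `-1` preserves the product law and
  -- multiplies the difference there by that sign.
  set swp : (ι → S × S) → (ι → S × S) :=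
    fun u i => if ε i then u i else (u i).swap with hswp
  have hswap : MeasurePreserving swp (Measure.pi fun _ : ι => μ.prod μ)
      (Measure.pi fun _ : ι => μ.prod μ) := by
    refine measurePreserving_pi (fun _ : ι => μ.prod μ) (fun _ : ι => μ.prod μ)
      (f := fun i q => if ε i then q else q.swap) fun i => ?_
    cases ε i
    · simpa using Measure.measurePreserving_swap
    · simpa using! MeasurePreserving.id (μ.prod μ)
  calc ∫⁻ x, ⨆ t, ‖∑ i, (h t i (x i) - ∫ s, h t i s ∂μ)‖ₑ ∂π
      ≤ ∫⁻ x, ∫⁻ y, G (x, y) ∂π ∂π := by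
        refine lintegral_mono fun x => iSup_le fun t =>
          (enorm_sum_sub_integral_le μ (h t) (hint t) x).trans (lintegral_mono fun y => ?_)
        exact le_iSup (fun t => ‖∑ i, (h t i (x i) - h t i (y i))‖ₑ) t
    _ = ∫⁻ q, G q ∂(π.prod π) := (lintegral_prod _ hGm.aemeasurable).symm
    _ = ∫⁻ u, G (fun i => (u i).1, fun i => (u i).2) ∂(Measure.pi fun _ : ι => μ.prod μ) :=
        (harrow.lintegral_comp hGm).symm
    _ = ∫⁻ u, G (fun i => (swp u i).1, fun i => (swp u i).2)
          ∂(Measure.pi fun _ : ι => μ.prod μ) :=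
        (hswap.lintegral_comp (hGm.comp harrow.measurable)).symm
    _ ≤ ∫⁻ u, (R (fun i => (u i).1) + R (fun i => (u i).2))
          ∂(Measure.pi fun _ : ι => μ.prod μ) := by
        refine lintegral_mono fun u => iSup_le fun t => ?_
        have : ∑ i, (h t i (swp u i).1 - h t i (swp u i).2)
            = ∑ i, boolSign (ε i) * h t i (u i).1 - ∑ i, boolSign (ε i) * h t i (u i).2 := by
          rw [← Finset.sum_sub_distrib]
          refine Finset.sum_congr rfl fun i _ => ?_
          simp only [hswp]
          cases ε i <;> simp [boolSign]
          ring
        dsimp only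
        rw [this]
        refine (enorm_sub_le).trans (add_le_add ?_ ?_)
        · exact le_iSup (fun t => ‖∑ i, boolSign (ε i) * h t i (u i).1‖ₑ) t
        · exact le_iSup (fun t => ‖∑ i, boolSign (ε i) * h t i (u i).2‖ₑ) t
    _ = ∫⁻ q, (R q.1 + R q.2) ∂(π.prod π) :=
        harrow.lintegral_comp ((hRm.comp measurable_fst).add (hRm.comp measurable_snd))
    _ = 2 * ∫⁻ x, R x ∂π := by
        rw [lintegral_add_left (f := fun q : (ι → S) × (ι → S) => R q.1) (hRm.comp measurable_fst),
          measurePreserving_fst.lintegral_comp hRm, measurePreserving_snd.lintegral_comp hRm,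
          two_mul]

/-- Symmetrization inequality. -/
theorem card_mul_lintegral_iSup_sub_integral_le {ι S T : Type*} [Fintype ι] [DecidableEq ι]
    [Countable T] [MeasurableSpace S] (μ : Measure S) [IsProbabilityMeasure μ]
    (h : T → ι → S → ℝ) (hm : ∀ t i, Measurable (h t i)) (hint : ∀ t i, Integrable (h t i) μ) :
    Fintype.card (ι → Bool) *
        ∫⁻ x, ⨆ t, ‖∑ i, (h t i (x i) - ∫ s, h t i s ∂μ)‖ₑ ∂(Measure.pi fun _ : ι => μ)
      ≤ 2 * ∫⁻ x, ∑ ε : ι → Bool, ⨆ t, ‖∑ i, boolSign (ε i) * h t i (x i)‖ₑ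
          ∂(Measure.pi fun _ : ι => μ) := by
  rw [lintegral_finsetSum, Finset.mul_sum, ← nsmul_eq_mul, ← Finset.card_univ]
  · exact Finset.card_nsmul_le_sum _ _ _
      fun ε _ => lintegral_iSup_sub_integral_le_of_signs μ h hm hint ε
  · intro ε _
    refine Measurable.iSup fun t => Measurable.enorm (Finset.measurable_sum _ fun i _ => ?_)
    exact ((hm t i).comp (measurable_pi_apply i)).const_mul _

/-! ### Truncation of the envelope and the uniform bound -/

/-- `F` is only a.e. measurable, yet the bound must hold at every point of the measurable set `A`.
Hence `A` also omits a measurable null set containing the points where `F` differs from its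
measurable version. -/
theorem exists_truncation {S : Type*} [MeasurableSpace S] {μ : Measure S} [IsFiniteMeasure μ]
    {F : S → ℝ} (hF : Integrable F μ) {τ : ℝ≥0∞} (hτ : τ ≠ 0) :
    ∃ A : Set S, MeasurableSet A ∧ ∃ K : ℝ, 0 < K ∧ (∀ x ∈ A, F x ≤ K) ∧
      ∫⁻ x in Aᶜ, ‖F x‖ₑ ∂μ ≤ τ := by
  obtain ⟨δ, hδ, hsmall⟩ := exists_pos_setLIntegral_lt_of_measure_lt
    (hasFiniteIntegral_def _ _ |>.1 hF.2).ne hτ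
  set F' := hF.1.mk F
  have hF'm : Measurable F' := hF.1.stronglyMeasurable_mk.measurable
  set E : Set S := toMeasurable μ {x | F x ≠ F' x}
  have hE : μ E = 0 := by
    rw [measure_toMeasurable]
    exact hF.1.ae_eq_mk
  have hlim : Tendsto (fun k : ℕ => μ {x | (k : ℝ) < F' x}) atTop (𝓝 0) := by
    have := tendsto_measure_iInter_atTop (μ := μ) (s := fun k : ℕ => {x | (k : ℝ) < F' x})
      (fun k => (measurableSet_lt measurable_const hF'm).nullMeasurableSet)
      (fun a b hab x (hx : (b : ℝ) < F' x) =>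
        show (a : ℝ) < F' x from lt_of_le_of_lt (by exact_mod_cast hab) hx)
      ⟨0, measure_ne_top _ _⟩
    have hempty : ⋂ k : ℕ, {x | (k : ℝ) < F' x} = ∅ := by
      ext x
      simpa using exists_nat_ge (F' x)
    rwa [hempty, measure_empty] at this
  obtain ⟨k, hk, hk1⟩ := ((hlim.eventually_lt_const hδ).and (eventually_ge_atTop 1)).exists
  refine ⟨Eᶜ ∩ {x | F' x ≤ k}, (measurableSet_toMeasurable _ _).compl.inter
    (measurableSet_le hF'm measurable_const), k, by exact_mod_cast hk1, ?_, ?_⟩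
  · rintro x ⟨hx, hxk⟩
    have : F x = F' x := by
      by_contra hne
      exact hx (subset_toMeasurable _ _ hne)
    rw [this]; exact hxk
  · refine (hsmall _ ?_).le
    refine lt_of_le_of_lt (measure_mono (t := E ∪ {x | (k : ℝ) < F' x}) ?_) ?_
    · intro x hx
      by_contra hcon
      simp only [Set.mem_union, Set.mem_ofPred_eq, not_or, not_lt] at hcon
      exact hx ⟨hcon.1, hcon.2⟩
    · exact lt_of_le_of_lt (measure_union_le _ _) (by rwa [hE, zero_add])

/-- Uniform bound for weighted Rademacher processes over a class with an integrable envelope and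
finite uniform covering numbers. -/
theorem exists_rademacher_bound {S : Type*} [MeasurableSpace S] [MeasurableSingletonClass S]
    {μ : Measure S} [IsFiniteMeasure μ] {𝓕 : Set (S → ℝ)} {F : S → ℝ} (henv : IsEnvelope 𝓕 F)
    (hF : Integrable F μ) (hcov : FiniteUniformCovering 𝓕 F) {𝓖 : Set (S → ℝ)} (h𝓖 : 𝓖 ⊆ 𝓕)
    (hcount : 𝓖.Countable) (hm : ∀ g ∈ 𝓖, Measurable g) {θ : ℝ} (hθ : 0 < θ) :
    ∃ n₀ : ℝ, 0 < n₀ ∧ ∃ B : S → ℝ≥0∞, Measurable B ∧ ∫⁻ x, B x ∂μ ≤ ENNReal.ofReal θ ∧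
      ∀ (n : ℝ), n₀ ≤ n → ∀ (ι : Type) [Fintype ι] [DecidableEq ι] (w : ι → S) (z : ι → ℝ),
        (∀ i, 0 ≤ z i) → (∀ i, z i ≤ 1) →
        ∑ ε : ι → Bool, ⨆ g : 𝓖, ‖∑ i, boolSign (ε i) * (z i * g.1 (w i))‖ₑ
          ≤ Fintype.card (ι → Bool) * (ENNReal.ofReal (θ * ∑ i, z i + θ * n)
            + ∑ i, ENNReal.ofReal (z i) * B (w i)) := by
  obtain ⟨A, hAm, K, hK, hAK, hAτ⟩ := exists_truncation hF (ENNReal.ofReal_pos.2 hθ).ne'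
  obtain ⟨c, hc⟩ := hcov.exists_net (show 0 < θ / (4 * K) by positivity)
  have : Countable 𝓖 := hcount
  -- `D` replaces `F` as envelope of the countable class `𝓖`, because it is genuinely measurable.
  set D : S → ℝ≥0∞ := fun x => ⨆ g : 𝓖, ‖g.1 x‖ₑ with hD
  have hDm : Measurable D := Measurable.iSup fun g => (hm g.1 g.2).enorm
  have hDF (x : S) : D x ≤ ‖F x‖ₑ := iSup_le fun g => by
    rw [Real.enorm_eq_ofReal_abs, Real.enorm_eq_ofReal_abs]
    exact ENNReal.ofReal_le_ofReal ((henv g.1 (h𝓖 g.2) x).trans (le_abs_self _))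
  -- With `s = √n ≥ r`, the first summand gives `c * K ^ 2 / s ≤ θ / 2` and the second gives `c * s
  -- ≤ θ * n`; the `1` ensures positivity. The net radius `θ / (4 * K)` supplies the other `θ / 2`.
  set r : ℝ := 2 * c * K ^ 2 / θ + c / θ + 1 with hr
  have hr0 : 0 < r := by positivity
  refine ⟨r ^ 2, by positivity, Aᶜ.indicator D, hDm.indicator hAm.compl, ?_, ?_⟩
  · rw [lintegral_indicator hAm.compl]
    exact (lintegral_mono fun x => hDF x).trans hAτ
  · intro n hn ι _ _ w z hz0 hz1
    have hn0 : 0 < n := lt_of_lt_of_le (by positivity) hn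
    have hrs : r ≤ √n := Real.le_sqrt_of_sq_le hn
    have hs : 0 < √n := Real.sqrt_pos.2 hn0
    refine (sum_boolSign_iSup_le henv (by positivity) hc hK hAK h𝓖
      (fun g hg x => le_iSup (fun g : 𝓖 => ‖g.1 x‖ₑ) ⟨g, hg⟩) hs w z hz0 hz1).trans ?_
    have hzs : 0 ≤ ∑ i, z i := Finset.sum_nonneg fun i _ => hz0 i
    have h1 : c * K ^ 2 / √n ≤ θ / 2 := by
      rw [div_le_iff₀ hs]
      have : 2 * c * K ^ 2 / θ ≤ √n := le_trans (by rw [hr]; have : (0:ℝ) ≤ c / θ := by positivity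
                                                    linarith) hrs
      rw [div_le_iff₀ hθ] at this
      linarith
    have h2 : c * √n ≤ θ * n := by
      have : c / θ ≤ √n := le_trans (by
        rw [hr]; have : (0:ℝ) ≤ 2 * c * K ^ 2 / θ := by positivity
        linarith) hrs
      rw [div_le_iff₀ hθ] at this
      calc c * √n ≤ (√n * θ) * √n := by gcongr
        _ = θ * (√n * √n) := by ring
        _ = θ * n := by rw [Real.mul_self_sqrt hn0.le]
    have h3 : 2 * (θ / (4 * K)) * K = θ / 2 := by field_simp; ring
    gcongr
    rw [h3]; linarith

/-! ### Bernoulli sampling -/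

theorem ae_bernoulliMeasure (p : unitInterval) :
    ∀ᵐ z ∂(bernoulliMeasure (1 : ℝ) 0 p), 0 ≤ z ∧ z ≤ 1 := by
  rw [ae_iff, bernoulliMeasure_apply_of_notMem_of_notMem]
  · exact (measurableSet_Icc (a := (0:ℝ)) (b := 1)).compl
  · simp
  · simp

theorem integrable_id_bernoulliMeasure (p : unitInterval) :
    Integrable (fun z : ℝ => z) (bernoulliMeasure (1 : ℝ) 0 p) := by
  refine Integrable.of_bound measurable_id.aestronglyMeasurable 1 ?_
  filter_upwards [ae_bernoulliMeasure p] with z hz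
  rw [Real.norm_eq_abs, abs_of_nonneg hz.1]
  exact hz.2

theorem integral_id_bernoulliMeasure (p : unitInterval) :
    ∫ z : ℝ, z ∂(bernoulliMeasure (1 : ℝ) 0 p) = p := by
  rw [integral_bernoulliMeasure]
  simp

theorem lintegral_ofReal_bernoulliMeasure (p : unitInterval) :
    ∫⁻ z : ℝ, ENNReal.ofReal z ∂(bernoulliMeasure (1 : ℝ) 0 p) = ENNReal.ofReal p := by
  rw [← ofReal_integral_eq_lintegral_ofReal (integrable_id_bernoulliMeasure p)
    ((ae_bernoulliMeasure p).mono fun z hz => hz.1), integral_id_bernoulliMeasure]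

/-- Cancels the number of sign patterns, which stands in for averaging over signs. -/
theorem ENNReal.le_of_natCast_mul_le {n : ℕ} (hn : n ≠ 0) {a b : ℝ≥0∞}
    (h : (n : ℝ≥0∞) * a ≤ 2 * (n * b)) : a ≤ 2 * b := by
  rw [mul_left_comm] at h
  exact (ENNReal.mul_le_mul_iff_right (by exact_mod_cast hn) (ENNReal.natCast_ne_top n)).1 h

/-- Bound for Bernoulli sampling from fixed points. -/
theorem lintegral_iSup_bernoulli_le {S ι : Type*} [Fintype ι] [DecidableEq ι]
    {𝓖 : Set (S → ℝ)} (hcount : 𝓖.Countable) {B : S → ℝ≥0∞} {θ n : ℝ} (hθ : 0 < θ) (hn : 0 < n)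
    (w : ι → S)
    (hB : ∀ z : ι → ℝ, (∀ i, 0 ≤ z i) → (∀ i, z i ≤ 1) →
      ∑ ε : ι → Bool, ⨆ g : 𝓖, ‖∑ i, boolSign (ε i) * (z i * g.1 (w i))‖ₑ
        ≤ Fintype.card (ι → Bool) * (ENNReal.ofReal (θ * ∑ i, z i + θ * n)
          + ∑ i, ENNReal.ofReal (z i) * B (w i))) (p : unitInterval) :
    ∫⁻ z, ⨆ g : 𝓖, ‖∑ i, (z i * g.1 (w i) - p * g.1 (w i))‖ₑ
        ∂(Measure.pi fun _ : ι => bernoulliMeasure (1 : ℝ) 0 p)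
      ≤ 2 * (ENNReal.ofReal (θ * (p * Fintype.card ι) + θ * n)
          + ∑ i, ENNReal.ofReal p * B (w i)) := by
  have : Countable 𝓖 := hcount
  set ν := bernoulliMeasure (1 : ℝ) 0 p
  have hp (i : ι) : MeasurePreserving (fun y : ι → ℝ => y i) (Measure.pi fun _ : ι => ν) ν :=
    measurePreserving_eval (fun _ : ι => ν) i
  -- The points `w` are frozen; symmetrization acts on the selection variables alone.
  have hsym := card_mul_lintegral_iSup_sub_integral_le (ι := ι) ν
    (fun (g : 𝓖) i (z : ℝ) => z * g.1 (w i)) (fun g i => by fun_prop)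
    (fun g i => (integrable_id_bernoulliMeasure p).mul_const _)
  simp only [integral_mul_const, ν, integral_id_bernoulliMeasure] at hsym
  refine ENNReal.le_of_natCast_mul_le Fintype.card_ne_zero (hsym.trans ?_)
  gcongr
  have hae : ∀ᵐ z ∂(Measure.pi fun _ : ι => ν), ∀ i, 0 ≤ z i ∧ z i ≤ 1 :=
    ae_all_iff.2 fun i => (hp i).quasiMeasurePreserving.ae (ae_bernoulliMeasure p)
  calc _ ≤ ∫⁻ z, Fintype.card (ι → Bool) * (ENNReal.ofReal θ * ∑ i, ENNReal.ofReal (z i)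
            + ENNReal.ofReal (θ * n) + ∑ i, ENNReal.ofReal (z i) * B (w i))
            ∂(Measure.pi fun _ : ι => ν) := by
        refine lintegral_mono_ae ?_
        filter_upwards [hae] with z hz
        have hzs : 0 ≤ ∑ i, z i := Finset.sum_nonneg fun i _ => (hz i).1
        have := hB z (fun i => (hz i).1) (fun i => (hz i).2)
        rwa [ENNReal.ofReal_add (by positivity) (by positivity), ENNReal.ofReal_mul hθ.le,
          ENNReal.ofReal_sum_of_nonneg fun i _ => (hz i).1] at this
    _ = _ := by
        have hi (i : ι) : ∫⁻ z, ENNReal.ofReal (z i) ∂(Measure.pi fun _ : ι => ν)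
            = ENNReal.ofReal p :=
          ((hp i).lintegral_comp ENNReal.measurable_ofReal).trans
            (lintegral_ofReal_bernoulliMeasure p)
        have hm (i : ι) : Measurable fun z : ι → ℝ => ENNReal.ofReal (z i) := by fun_prop
        have hm1 : Measurable fun z : ι → ℝ => ∑ i, ENNReal.ofReal (z i) := by fun_prop
        have hm2 : Measurable fun z : ι → ℝ => ∑ i, ENNReal.ofReal (z i) * B (w i) := by fun_prop
        rw [lintegral_const_mul _ (by fun_prop), lintegral_add_right _ hm2,
          lintegral_add_right _ measurable_const, lintegral_const_mul _ hm1,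
          lintegral_finsetSum _ fun i _ => hm i,
          lintegral_finsetSum _ fun i _ => (hm i).mul_const _]
        simp_rw [lintegral_mul_const _ (hm _), hi]
        simp only [Finset.sum_const, Finset.card_univ, nsmul_eq_mul, lintegral_const, measure_univ,
          mul_one]
        have hp0 : (0 : ℝ) ≤ p := p.2.1
        rw [ENNReal.ofReal_add (by positivity) (by positivity),
          ENNReal.ofReal_mul (p := θ) (q := (p : ℝ) * Fintype.card ι) hθ.le,
          ENNReal.ofReal_mul (p := (p : ℝ)) hp0, ENNReal.ofReal_natCast, mul_comm (Fintype.card ι : ℝ≥0∞)]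

/-- Bound for Bernoulli sampling from random points with a common marginal law. -/
theorem lintegral_iSup_sampling_le {Ω S ι : Type*} [MeasurableSpace Ω] [MeasurableSpace S]
    [Fintype ι] [DecidableEq ι] {P : Measure Ω} [IsProbabilityMeasure P] {μ : Measure S}
    {𝓖 : Set (S → ℝ)} (hcount : 𝓖.Countable) (hm : ∀ g ∈ 𝓖, Measurable g)
    {B : S → ℝ≥0∞} (hBm : Measurable B) {θ : ℝ} (hθ : 0 < θ)
    (hBθ : ∫⁻ x, B x ∂μ ≤ ENNReal.ofReal θ) (p : unitInterval) (hn : 0 < (p : ℝ) * Fintype.card ι)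
    (hB : ∀ (w : ι → S) (z : ι → ℝ), (∀ i, 0 ≤ z i) → (∀ i, z i ≤ 1) →
      ∑ ε : ι → Bool, ⨆ g : 𝓖, ‖∑ i, boolSign (ε i) * (z i * g.1 (w i))‖ₑ
        ≤ Fintype.card (ι → Bool) * (ENNReal.ofReal
            (θ * ∑ i, z i + θ * (p * Fintype.card ι)) + ∑ i, ENNReal.ofReal (z i) * B (w i)))
    {W : ι → Ω → S} (hW : ∀ i, Measurable (W i)) (hμ : ∀ i, P.map (W i) = μ)
    {Z : ι → Ω → ℝ} (hZ : ∀ i, HasLaw (Z i) (bernoulliMeasure 1 0 p) P) (hZi : iIndepFun Z P)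
    (hZW : IndepFun (fun ω i => Z i ω) (fun ω i => W i ω) P) :
    AEMeasurable (fun ω => ⨆ g : 𝓖, ‖∑ i, (Z i ω * g.1 (W i ω) - p * g.1 (W i ω))‖ₑ) P ∧
    ∫⁻ ω, ⨆ g : 𝓖, ‖∑ i, (Z i ω * g.1 (W i ω) - p * g.1 (W i ω))‖ₑ ∂P
      ≤ ENNReal.ofReal (6 * θ * (p * Fintype.card ι)) := by
  have : Countable 𝓖 := hcount
  have hp0 : (0 : ℝ) ≤ p := p.2.1
  set Φ : (ι → ℝ) × (ι → S) → ℝ≥0∞ :=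
    fun q => ⨆ g : 𝓖, ‖∑ i, (q.1 i * g.1 (q.2 i) - p * g.1 (q.2 i))‖ₑ with hΦ
  have hΦm : Measurable Φ := by
    have hg (g : 𝓖) : Measurable fun q : (ι → ℝ) × (ι → S) =>
        ‖∑ i, (q.1 i * g.1 (q.2 i) - p * g.1 (q.2 i))‖ₑ := by
      have := hm g.1 g.2
      fun_prop
    exact Measurable.iSup hg
  have hZm : AEMeasurable (fun ω i => Z i ω) P := aemeasurable_pi_lambda _ fun i =>
    (hZ i).aemeasurable
  have hWm : Measurable (fun ω i => W i ω) := measurable_pi_lambda _ hW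
  have hZlaw : P.map (fun ω i => Z i ω) = Measure.pi fun _ : ι => bernoulliMeasure (1 : ℝ) 0 p := by
    rw [(iIndepFun_iff_map_fun_eq_pi_map fun i => (hZ i).aemeasurable).1 hZi]
    simp_rw [(hZ _).map_eq]
  have hjoint := (indepFun_iff_map_prod_eq_prod_map_map hZm hWm.aemeasurable).1 hZW
  have : IsProbabilityMeasure (P.map fun ω i => W i ω) :=
    Measure.isProbabilityMeasure_map hWm.aemeasurable
  have hΦω : AEMeasurable (fun ω => Φ (fun i => Z i ω, fun i => W i ω)) P :=
    hΦm.comp_aemeasurable (hZm.prodMk hWm.aemeasurable)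
  refine ⟨hΦω, ?_⟩
  calc ∫⁻ ω, Φ (fun i => Z i ω, fun i => W i ω) ∂P
      = ∫⁻ q, Φ q ∂(P.map fun ω => (fun i => Z i ω, fun i => W i ω)) :=
        (lintegral_map' hΦm.aemeasurable (hZm.prodMk hWm.aemeasurable)).symm
    _ = ∫⁻ w, ∫⁻ z, Φ (z, w) ∂(Measure.pi fun _ : ι => bernoulliMeasure (1 : ℝ) 0 p)
          ∂(P.map fun ω i => W i ω) := by
        -- Independence of `Z` and `W` allows integrating over `Z` first. The law of `W` then enters
        -- only through `∑ i, B (w i)`, hence through marginals.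
        rw [hjoint, hZlaw, lintegral_prod_symm _ hΦm.aemeasurable]
    _ ≤ ∫⁻ w : ι → S, 2 * (ENNReal.ofReal (θ * (p * Fintype.card ι) + θ * (p * Fintype.card ι))
          + ∑ i, ENNReal.ofReal p * B (w i)) ∂(P.map fun ω i => W i ω) :=
        lintegral_mono fun w => lintegral_iSup_bernoulli_le hcount hθ hn w (hB w) p
    _ = 2 * (ENNReal.ofReal (θ * (p * Fintype.card ι) + θ * (p * Fintype.card ι))
          + ∑ i : ι, ENNReal.ofReal p * ∫⁻ x, B x ∂μ) := by
        have hi (i : ι) : ∫⁻ w : ι → S, B (w i) ∂(P.map fun ω i => W i ω) = ∫⁻ x, B x ∂μ := by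
          rw [lintegral_map (by fun_prop) hWm, ← hμ i, lintegral_map hBm (hW i)]
        have hmB (i : ι) : Measurable fun w : ι → S => B (w i) := by fun_prop
        rw [lintegral_const_mul _ (by fun_prop), lintegral_add_left measurable_const,
          lintegral_finsetSum _ fun i _ => (hmB i).const_mul _]
        simp_rw [lintegral_const_mul _ (hmB _), hi]
        simp
    _ ≤ 2 * (ENNReal.ofReal (θ * (p * Fintype.card ι) + θ * (p * Fintype.card ι))
          + ∑ i : ι, ENNReal.ofReal p * ENNReal.ofReal θ) := by gcongr
    _ = ENNReal.ofReal (6 * θ * (p * Fintype.card ι)) := by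
        rw [Finset.sum_const, Finset.card_univ, nsmul_eq_mul, ← ENNReal.ofReal_mul hp0,
          ← ENNReal.ofReal_natCast, ← ENNReal.ofReal_mul (by positivity),
          ← ENNReal.ofReal_add (by positivity) (by positivity), ← ENNReal.ofReal_ofNat 2,
          ← ENNReal.ofReal_mul (by norm_num)]
        congr 1
        ring

/-! ### I.i.d. samples -/

/-- Uniform bound for an i.i.d. sample. -/
theorem lintegral_iSup_iid_le {S ι : Type*} [MeasurableSpace S]
    [Fintype ι] [DecidableEq ι] [Nonempty ι] {μ : Measure S} [IsProbabilityMeasure μ]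
    {𝓖 : Set (S → ℝ)} (hcount : 𝓖.Countable) (hm : ∀ g ∈ 𝓖, Measurable g)
    (hint : ∀ g ∈ 𝓖, Integrable g μ)
    {B : S → ℝ≥0∞} (hBm : Measurable B) {θ : ℝ} (hθ : 0 < θ)
    (hBθ : ∫⁻ x, B x ∂μ ≤ ENNReal.ofReal θ)
    (hB : ∀ (w : ι → S) (z : ι → ℝ), (∀ i, 0 ≤ z i) → (∀ i, z i ≤ 1) →
      ∑ ε : ι → Bool, ⨆ g : 𝓖, ‖∑ i, boolSign (ε i) * (z i * g.1 (w i))‖ₑ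
        ≤ Fintype.card (ι → Bool) * (ENNReal.ofReal
            (θ * ∑ i, z i + θ * Fintype.card ι) + ∑ i, ENNReal.ofReal (z i) * B (w i))) :
    ∫⁻ x, ⨆ g : 𝓖, ‖∑ i, (g.1 (x i) - ∫ s, g.1 s ∂μ)‖ₑ ∂(Measure.pi fun _ : ι => μ)
      ≤ ENNReal.ofReal (6 * θ * Fintype.card ι) := by
  have : Countable 𝓖 := hcount
  have hsym := card_mul_lintegral_iSup_sub_integral_le (ι := ι) μ
    (fun (g : 𝓖) _ => g.1) (fun g _ => hm g.1 g.2) (fun g _ => hint g.1 g.2)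
  have hcalc : 2 * (ENNReal.ofReal (θ * Fintype.card ι + θ * Fintype.card ι)
          + ∑ i : ι, ENNReal.ofReal θ) = ENNReal.ofReal (6 * θ * Fintype.card ι) := by
    rw [Finset.sum_const, Finset.card_univ, nsmul_eq_mul,
      ← ENNReal.ofReal_natCast, ← ENNReal.ofReal_mul (by positivity),
      ← ENNReal.ofReal_add (by positivity) (by positivity), ← ENNReal.ofReal_ofNat 2,
      ← ENNReal.ofReal_mul (by norm_num)]
    congr 1
    ring
  rw [← hcalc]
  refine ENNReal.le_of_natCast_mul_le Fintype.card_ne_zero (hsym.trans ?_)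
  gcongr
  have hmB (i : ι) : Measurable fun w : ι → S => B (w i) := by fun_prop
  calc _ ≤ ∫⁻ x : ι → S, Fintype.card (ι → Bool) *
          (ENNReal.ofReal (θ * Fintype.card ι + θ * Fintype.card ι) + ∑ i, B (x i))
            ∂(Measure.pi fun _ : ι => μ) := by
        refine lintegral_mono fun x => ?_
        -- The Rademacher bound with all weights equal to `1`.
        simpa using hB x (fun _ => 1) (fun _ => zero_le_one) (fun _ => le_rfl)
    _ = Fintype.card (ι → Bool) *
          (ENNReal.ofReal (θ * Fintype.card ι + θ * Fintype.card ι) + ∑ i : ι, ∫⁻ x, B x ∂μ) := by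
        rw [lintegral_const_mul _ (by fun_prop), lintegral_add_left measurable_const,
          lintegral_finsetSum _ fun i _ => hmB i]
        simp_rw [fun i : ι => (measurePreserving_eval (fun _ : ι => μ) i).lintegral_comp hBm]
        simp
    _ ≤ _ := by gcongr

/-! ### Exchangeable dissociated arrays and their diagonals -/

theorem SeparatelyExchangeable.map_eq {Ω S : Type*} [MeasurableSpace Ω] [MeasurableSpace S]
    {P : Measure Ω} {W : ℕ → ℕ → Ω → S} (h : SeparatelyExchangeable P W) (i j : ℕ) :
    P.map (W i j) = P.map (W 0 0) := by
  have := (h (Equiv.swap 0 i) (Equiv.swap 0 j)).comp (measurable_pi_apply ((0, 0) : ℕ × ℕ))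
  simpa [Function.comp_def] using! this.map_eq.symm

/-- Peel off the largest index `a`: cutting rows and columns at `a` puts `(a, a)` in one block and
all smaller diagonal entries in the opposite one. -/
theorem Dissociated.iIndepFun_diag {Ω S : Type*} [MeasurableSpace Ω] [MeasurableSpace S]
    {P : Measure Ω} [IsProbabilityMeasure P] {W : ℕ → ℕ → Ω → S} (h : Dissociated P W) :
    iIndepFun (fun i : ℕ => W i i) P := by
  classical
  rw [iIndepFun_iff_measure_inter_preimage_eq_mul]
  intro s A
  induction s using Finset.induction_on_max with
  | empty => simp
  | insert a s hs ih =>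
    intro hA
    have hA' (i : ℕ) (hi : i ∈ s) : MeasurableSet (A i) := hA i (Finset.mem_insert_of_mem hi)
    have hnot : a ∉ s := fun ha => lt_irrefl _ (hs a ha)
    rw [Finset.set_biInter_insert, Finset.prod_insert hnot, ← ih hA']
    have hind := (h a a).measure_inter_preimage_eq_mul
      (⋂ (i : ℕ) (hi : i < a) (_ : i ∈ s), (fun x => x ⟨(i, i), hi, hi⟩) ⁻¹' A i)
      ((fun x => x ⟨(a, a), le_rfl, le_rfl⟩) ⁻¹' A a)
      (MeasurableSet.iInter fun i => MeasurableSet.iInter fun hi => MeasurableSet.iInter fun his =>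
        measurable_pi_apply _ (hA' i his))
      (measurable_pi_apply _ (hA a (Finset.mem_insert_self _ _)))
    have hset : (fun ω (ij : {ij : ℕ × ℕ // ij.1 < a ∧ ij.2 < a}) => W ij.1.1 ij.1.2 ω) ⁻¹'
        (⋂ (i : ℕ) (hi : i < a) (_ : i ∈ s), (fun x => x ⟨(i, i), hi, hi⟩) ⁻¹' A i)
        = ⋂ i ∈ s, W i i ⁻¹' A i := by
      ext ω
      simp only [Set.mem_preimage, Set.mem_iInter]
      exact ⟨fun H i hi => H i (hs i hi) hi, fun H i _ hi => H i hi⟩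
    rw [hset] at hind
    rw [Set.inter_comm, mul_comm]
    exact hind

theorem map_diag_eq_pi {Ω S : Type*} [MeasurableSpace Ω] [MeasurableSpace S]
    {P : Measure Ω} [IsProbabilityMeasure P] {W : ℕ → ℕ → Ω → S}
    (hW : ∀ i j, Measurable (W i j)) (hexch : SeparatelyExchangeable P W)
    (hdiss : Dissociated P W) (m : ℕ) :
    P.map (fun ω (r : Fin m) => W r r ω) = Measure.pi fun _ : Fin m => P.map (W 0 0) := by
  have hind : iIndepFun (fun r : Fin m => W r r) P :=
    hdiss.iIndepFun_diag.precomp Fin.val_injective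
  rw [(iIndepFun_iff_map_fun_eq_pi_map fun r : Fin m => (hW r r).aemeasurable).1 hind]
  simp_rw [hexch.map_eq]

/-- A permutation of the first `N` integers, extended to `ℕ`. -/
noncomputable def finPermExtend {N : ℕ} (σ : Equiv.Perm (Fin N)) : Equiv.Perm ℕ :=
  σ.extendDomain Fin.equivSubtype

theorem finPermExtend_apply {N : ℕ} (σ : Equiv.Perm (Fin N)) (i : Fin N) :
    finPermExtend σ i = σ i :=
  σ.extendDomain_apply_image Fin.equivSubtype i

/-- The total of an array as an average of totals over shifted diagonals. -/
theorem nsmul_sum_prod_eq_sum_shift {N M m : ℕ} [NeZero N] [NeZero M] (hN : m ≤ N) (hM : m ≤ M)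
    {E : Type*} [AddCommMonoid E] (a : Fin N × Fin M → E) :
    m • ∑ ij, a ij = ∑ kl : Fin N × Fin M, ∑ r : Fin m,
      a (Fin.castLE hN r + kl.1, Fin.castLE hM r + kl.2) := by
  rw [Finset.sum_comm]
  -- Addition in `Fin` is cyclic, so for fixed `r` the shift permutes the whole grid.
  have (r : Fin m) : ∑ kl : Fin N × Fin M, a (Fin.castLE hN r + kl.1, Fin.castLE hM r + kl.2)
      = ∑ ij, a ij :=
    Fintype.sum_equiv ((Equiv.addLeft (Fin.castLE hN r)).prodCongr
      (Equiv.addLeft (Fin.castLE hM r))) _ _ fun kl => rfl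
  simp [this]

/-- Uniform bound for the full array, by averaging over diagonals, which are i.i.d. -/
theorem lintegral_iSup_array_le {Ω S : Type*} [MeasurableSpace Ω] [MeasurableSpace S]
    {P : Measure Ω} [IsProbabilityMeasure P] {W : ℕ → ℕ → Ω → S}
    (hW : ∀ i j, Measurable (W i j)) (hexch : SeparatelyExchangeable P W)
    (hdiss : Dissociated P W) {𝓖 : Set (S → ℝ)} (hcount : 𝓖.Countable)
    (hm : ∀ g ∈ 𝓖, Measurable g) (hint : ∀ g ∈ 𝓖, Integrable g (P.map (W 0 0)))
    {B : S → ℝ≥0∞} (hBm : Measurable B) {θ : ℝ} (hθ : 0 < θ)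
    (hBθ : ∫⁻ x, B x ∂(P.map (W 0 0)) ≤ ENNReal.ofReal θ) {N M m : ℕ} (hm0 : 0 < m)
    (hN : m ≤ N) (hM : m ≤ M)
    (hB : ∀ (w : Fin m → S) (z : Fin m → ℝ), (∀ i, 0 ≤ z i) → (∀ i, z i ≤ 1) →
      ∑ ε : Fin m → Bool, ⨆ g : 𝓖, ‖∑ i, boolSign (ε i) * (z i * g.1 (w i))‖ₑ
        ≤ Fintype.card (Fin m → Bool) * (ENNReal.ofReal (θ * ∑ i, z i + θ * m)
          + ∑ i, ENNReal.ofReal (z i) * B (w i))) :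
    AEMeasurable (fun ω => ⨆ g : 𝓖, ‖∑ ij : Fin N × Fin M,
        (g.1 (W ij.1 ij.2 ω) - ∫ s, g.1 s ∂(P.map (W 0 0)))‖ₑ) P ∧
    ∫⁻ ω, ⨆ g : 𝓖, ‖∑ ij : Fin N × Fin M,
        (g.1 (W ij.1 ij.2 ω) - ∫ s, g.1 s ∂(P.map (W 0 0)))‖ₑ ∂P
      ≤ ENNReal.ofReal (6 * θ * (N * M)) := by
  have : Countable 𝓖 := hcount
  have : NeZero m := ⟨hm0.ne'⟩
  have : NeZero N := ⟨by omega⟩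
  have : NeZero M := ⟨by omega⟩
  set μ := P.map (W 0 0) with hμ
  have : IsProbabilityMeasure μ := Measure.isProbabilityMeasure_map (hW 0 0).aemeasurable
  have hmeas : Measurable (fun ω => ⨆ g : 𝓖, ‖∑ ij : Fin N × Fin M,
      (g.1 (W ij.1 ij.2 ω) - ∫ s, g.1 s ∂μ)‖ₑ) := by
    refine Measurable.iSup fun g => Measurable.enorm (Finset.measurable_sum _ fun ij _ => ?_)
    exact ((hm g.1 g.2).comp (hW ij.1 ij.2)).sub_const _
  refine ⟨hmeas.aemeasurable, ?_⟩
  set Ψ : (Fin m → S) → ℝ≥0∞ := fun x => ⨆ g : 𝓖, ‖∑ r, (g.1 (x r) - ∫ s, g.1 s ∂μ)‖ₑ with hΨ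
  have hΨm : Measurable Ψ := by
    refine Measurable.iSup fun g => Measurable.enorm (Finset.measurable_sum _ fun r _ => ?_)
    exact ((hm g.1 g.2).comp (measurable_pi_apply r)).sub_const _
  have hiid : ∫⁻ ω, Ψ (fun r : Fin m => W r r ω) ∂P ≤ ENNReal.ofReal (6 * θ * m) := by
    have hdm : Measurable (fun ω (r : Fin m) => W r r ω) :=
      measurable_pi_lambda _ fun r => hW r r
    rw [← lintegral_map hΨm hdm, map_diag_eq_pi hW hexch hdiss m]
    have := lintegral_iSup_iid_le (ι := Fin m) hcount hm hint hBm hθ hBθ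
    rw [Fintype.card_fin] at this
    exact this hB
  set sh : Fin N × Fin M → Ω → (Fin m → S) := fun kl ω r =>
    W (Fin.castLE hN r + kl.1 : Fin N) (Fin.castLE hM r + kl.2 : Fin M) ω with hsh
  have hshm (kl : Fin N × Fin M) : Measurable (sh kl) := measurable_pi_lambda _ fun r => hW _ _
  -- A shifted diagonal is the main diagonal after permuting rows and columns cyclically, so
  -- exchangeability gives it the same law.
  have hshift (kl : Fin N × Fin M) :
      ∫⁻ ω, Ψ (sh kl ω) ∂P = ∫⁻ ω, Ψ (fun r : Fin m => W r r ω) ∂P := by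
    have hcomp := (hexch (finPermExtend (Equiv.addRight kl.1))
      (finPermExtend (Equiv.addRight kl.2))).comp
      (u := fun (y : ℕ × ℕ → S) (r : Fin m) => y ((r : ℕ), (r : ℕ)))
      (measurable_pi_lambda _ fun r => measurable_pi_apply _)
    have := (hcomp.comp hΨm).lintegral_eq
    simp only [Function.comp_def] at this
    rw [this]
    congr! 3 with ω
    ext r
    have h1 := finPermExtend_apply (Equiv.addRight kl.1) (Fin.castLE hN r)
    have h2 := finPermExtend_apply (Equiv.addRight kl.2) (Fin.castLE hM r)
    simp only [Fin.val_castLE, Equiv.coe_addRight] at h1 h2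
    simp only [hsh, h1, h2]
  have hpt (ω : Ω) : (m : ℝ≥0∞) * ⨆ g : 𝓖, ‖∑ ij : Fin N × Fin M,
      (g.1 (W ij.1 ij.2 ω) - ∫ s, g.1 s ∂μ)‖ₑ ≤ ∑ kl : Fin N × Fin M, Ψ (sh kl ω) := by
    rw [ENNReal.mul_iSup]
    refine iSup_le fun g => ?_
    have hen : (m : ℝ≥0∞) = ‖(m : ℝ)‖ₑ := by simp
    rw [hen, ← enorm_mul, ← nsmul_eq_mul, nsmul_sum_prod_eq_sum_shift hN hM]
    refine (enorm_sum_le _ _).trans (Finset.sum_le_sum fun kl _ => ?_)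
    exact le_iSup (fun g : 𝓖 => ‖∑ r, (g.1 (sh kl ω r) - ∫ s, g.1 s ∂μ)‖ₑ) g
  have hm0' : (m : ℝ≥0∞) ≠ 0 := by exact_mod_cast hm0.ne'
  refine (ENNReal.mul_le_mul_iff_right hm0' (ENNReal.natCast_ne_top m)).1 ?_
  rw [← lintegral_const_mul _ hmeas]
  calc _ ≤ ∫⁻ ω, ∑ kl : Fin N × Fin M, Ψ (sh kl ω) ∂P := lintegral_mono hpt
    _ = ∑ kl : Fin N × Fin M, ∫⁻ ω, Ψ (sh kl ω) ∂P :=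
        lintegral_finsetSum _ fun kl _ => hΨm.comp (hshm kl)
    _ ≤ ∑ kl : Fin N × Fin M, ENNReal.ofReal (6 * θ * m) :=
        Finset.sum_le_sum fun kl _ => (hshift kl).trans_le hiid
    _ = _ := by
        rw [Finset.sum_const, Finset.card_univ, nsmul_eq_mul, ← ENNReal.ofReal_natCast,
          ← ENNReal.ofReal_natCast, ← ENNReal.ofReal_mul (by positivity),
          ← ENNReal.ofReal_mul (by positivity)]
        congr 1
        simp only [Fintype.card_prod, Fintype.card_fin, Nat.cast_mul]
        ring

/-! ### Error decomposition and reduction to a countable class -/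

/-- Used for the class `{1}`, which turns the concentration of `L̂` into an instance of the sampling
bound. -/
theorem finiteUniformCovering_singleton {S : Type*} [MeasurableSpace S] (f F : S → ℝ) :
    FiniteUniformCovering {f} F := by
  intro ε _
  refine lt_of_le_of_lt (iSup₂_le fun Q _ => ?_) (ENat.natCast_lt_top 1)
  refine (iInf₂_le {f} ⟨subset_rfl, ?_⟩).trans (by simp)
  rintro t rfl
  exact ⟨t, rfl, by simp [l2Dist]⟩

/-- Deterministic error decomposition for a subsample mean on the event that the subsample size is
at least half of its expectation. -/
theorem abs_subsample_error_le {ι : Type*} [Fintype ι] (z y : ι → ℝ) {p e : ℝ} (hp : 0 ≤ p)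
    (hn : 0 < p * Fintype.card ι) (hV : |∑ i, (z i - p)| ≤ p * Fintype.card ι / 2) :
    |1 / (∑ i, z i) * ∑ i, z i * y i - e| * (p * Fintype.card ι / 2)
      ≤ |∑ i, (z i * y i - p * y i)| + p * |∑ i, (y i - e)| + |e| * |∑ i, (z i - p)| := by
  have hsum : ∑ i, (z i - p) = ∑ i, z i - p * Fintype.card ι := by
    rw [Finset.sum_sub_distrib]; simp [mul_comm]
  have hL : p * Fintype.card ι / 2 ≤ ∑ i, z i := by
    rw [hsum] at hV
    linarith [(abs_le.1 hV).1]
  have hL0 : 0 < ∑ i, z i := by linarith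
  have hdec : (1 / (∑ i, z i) * ∑ i, z i * y i - e) * ∑ i, z i
      = ∑ i, (z i * y i - p * y i) + p * ∑ i, (y i - e) - e * ∑ i, (z i - p) := by
    rw [hsum, Finset.sum_sub_distrib, Finset.sum_sub_distrib, ← Finset.mul_sum]
    simp only [Finset.sum_const, Finset.card_univ, nsmul_eq_mul]
    field_simp
    ring
  calc _ ≤ |1 / (∑ i, z i) * ∑ i, z i * y i - e| * ∑ i, z i := by gcongr
    _ = |(1 / (∑ i, z i) * ∑ i, z i * y i - e) * ∑ i, z i| := by
        rw [abs_mul, abs_of_pos hL0]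
    _ ≤ _ := by
        rw [hdec]
        refine (abs_sub _ _).trans ?_
        rw [abs_mul e]
        gcongr
        refine (abs_add_le _ _).trans ?_
        rw [abs_mul p, abs_of_nonneg hp]

/-- The supremum over a pointwise measurable class is a supremum over its countable subclass. -/
theorem iSup_subsample_error_le {Ω S : Type*} [MeasurableSpace Ω] [MeasurableSpace S]
    {P : Measure Ω} {X : Ω → S} (hX : Measurable X) {𝓕 𝓖 : Set (S → ℝ)} {F : S → ℝ}
    (henv : IsEnvelope 𝓕 F) (hF : Integrable F (P.map X)) (h𝓖 : 𝓖 ⊆ 𝓕)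
    (hm : ∀ g ∈ 𝓖, Measurable g)
    (hlim : ∀ f ∈ 𝓕, ∃ g : ℕ → S → ℝ,
      (∀ m, g m ∈ 𝓖) ∧ ∀ s, Tendsto (fun m => g m s) atTop (𝓝 (f s)))
    (W : ℕ → ℕ → Ω → S) {N M : ℕ} (Z : Fin N → Fin M → Ω → ℝ) (ω : Ω) :
    ⨆ f ∈ 𝓕, ENNReal.ofReal |subsampleMean W Z f ω - ∫ ω', f (X ω') ∂P|
      ≤ ⨆ g : 𝓖, ENNReal.ofReal |subsampleMean W Z g.1 ω - ∫ ω', g.1 (X ω') ∂P| := by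
  refine iSup₂_le fun f hf => ?_
  obtain ⟨g, hg, hgf⟩ := hlim f hf
  -- The centring must converge along with the subsample mean; the envelope dominates.
  have hint : Tendsto (fun m => ∫ ω', g m (X ω') ∂P) atTop (𝓝 (∫ ω', f (X ω') ∂P)) := by
    refine tendsto_integral_of_dominated_convergence (fun ω' => F (X ω'))
      (fun m => ((hm _ (hg m)).comp hX).aestronglyMeasurable) (hF.comp_measurable hX)
      (fun m => ae_of_all _ fun ω' => henv _ (h𝓖 (hg m)) _) (ae_of_all _ fun ω' => hgf _)
  have hmean : Tendsto (fun m => subsampleMean W Z (g m) ω) atTop (𝓝 (subsampleMean W Z f ω)) := by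
    unfold subsampleMean
    exact (tendsto_finsetSum _ fun i _ => tendsto_finsetSum _ fun j _ =>
      (hgf _).const_mul _).const_mul _
  exact le_of_tendsto (ENNReal.tendsto_ofReal (hmean.sub hint).abs) (Eventually.of_forall fun m =>
    le_iSup (fun g : 𝓖 => ENNReal.ofReal |subsampleMean W Z g.1 ω - ∫ ω', g.1 (X ω') ∂P|)
      ⟨g m, hg m⟩)

/-- If `L̂` is within `n / 2` of `n`, the decomposition applies and `κ ≤ δ / 2` suffices. Otherwise
the last term alone exceeds `κ * n`, because `κ ≤ 1 / 2` and its coefficient `C + 1` is at least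
`1`; this also covers `L̂ = 0`. -/
theorem le_of_ofReal_lt_iSup_subsample_error {Ω S : Type*} [MeasurableSpace Ω] [MeasurableSpace S]
    {P : Measure Ω} {X : Ω → S} {𝓖 : Set (S → ℝ)} {C : ℝ}
    (hC : ∀ g ∈ 𝓖, |∫ ω', g (X ω') ∂P| ≤ C)
    (W : ℕ → ℕ → Ω → S) {N M : ℕ} (Z : Fin N → Fin M → Ω → ℝ) {p : ℝ} (hp : 0 ≤ p)
    (hn : 0 < p * Fintype.card (Fin N × Fin M)) {δ κ : ℝ} (hδ : 0 < δ) (hC0 : 0 ≤ C)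
    (hκδ : κ ≤ δ / 2) (hκ : κ ≤ 1 / 2) (ω : Ω)
    (h : ENNReal.ofReal δ
      < ⨆ g : 𝓖, ENNReal.ofReal |subsampleMean W Z g.1 ω - ∫ ω', g.1 (X ω') ∂P|) :
    ENNReal.ofReal (κ * (p * Fintype.card (Fin N × Fin M)))
      ≤ (⨆ g : 𝓖, ‖∑ ij : Fin N × Fin M,
          (Z ij.1 ij.2 ω * g.1 (W ij.1 ij.2 ω) - p * g.1 (W ij.1 ij.2 ω))‖ₑ)
        + ENNReal.ofReal p * (⨆ g : 𝓖, ‖∑ ij : Fin N × Fin M,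
          (g.1 (W ij.1 ij.2 ω) - ∫ ω', g.1 (X ω') ∂P)‖ₑ)
        + ENNReal.ofReal (C + 1) * ‖∑ ij : Fin N × Fin M, (Z ij.1 ij.2 ω - p)‖ₑ := by
  set n : ℝ := p * Fintype.card (Fin N × Fin M) with hn_def
  rcases le_or_gt |∑ ij : Fin N × Fin M, (Z ij.1 ij.2 ω - p)| (n / 2) with hV | hV
  · calc ENNReal.ofReal (κ * n) ≤ ENNReal.ofReal (δ * (n / 2)) :=
          ENNReal.ofReal_le_ofReal (by nlinarith)
      _ = ENNReal.ofReal δ * ENNReal.ofReal (n / 2) := ENNReal.ofReal_mul hδ.le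
      _ ≤ (⨆ g : 𝓖, ENNReal.ofReal |subsampleMean W Z g.1 ω - ∫ ω', g.1 (X ω') ∂P|)
            * ENNReal.ofReal (n / 2) := by gcongr
      _ ≤ _ := by
        rw [ENNReal.iSup_mul]
        refine iSup_le fun g => ?_
        have hdet := abs_subsample_error_le (fun ij : Fin N × Fin M => Z ij.1 ij.2 ω)
          (fun ij => g.1 (W ij.1 ij.2 ω)) (e := ∫ ω', g.1 (X ω') ∂P) hp hn hV
        have hmean : 1 / (∑ ij : Fin N × Fin M, Z ij.1 ij.2 ω)
            * ∑ ij : Fin N × Fin M, Z ij.1 ij.2 ω * g.1 (W ij.1 ij.2 ω)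
            = subsampleMean W Z g.1 ω := by
          simp only [subsampleMean, subsampleSize, Fintype.sum_prod_type]
        rw [hmean] at hdet
        rw [← ENNReal.ofReal_mul (abs_nonneg _)]
        refine (ENNReal.ofReal_le_ofReal hdet).trans ?_
        rw [ENNReal.ofReal_add (by positivity) (by positivity),
          ENNReal.ofReal_add (by positivity) (by positivity), ENNReal.ofReal_mul hp,
          ENNReal.ofReal_mul (abs_nonneg _), ← Real.enorm_eq_ofReal_abs,
          ← Real.enorm_eq_ofReal_abs, ← Real.enorm_eq_ofReal_abs (∑ ij : Fin N × Fin M, _)]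
        refine add_le_add (add_le_add ?_ ?_) ?_
        · exact le_iSup (fun g : 𝓖 => ‖∑ ij : Fin N × Fin M,
            (Z ij.1 ij.2 ω * g.1 (W ij.1 ij.2 ω) - p * g.1 (W ij.1 ij.2 ω))‖ₑ) g
        · gcongr
          exact le_iSup (fun g : 𝓖 => ‖∑ ij : Fin N × Fin M,
            (g.1 (W ij.1 ij.2 ω) - ∫ ω', g.1 (X ω') ∂P)‖ₑ) g
        · gcongr
          linarith [hC g.1 g.2]
  · refine le_trans ?_ le_add_self
    rw [Real.enorm_eq_ofReal_abs, ← ENNReal.ofReal_mul (by positivity)]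
    refine ENNReal.ofReal_le_ofReal ?_
    nlinarith [abs_nonneg (∑ ij : Fin N × Fin M, (Z ij.1 ij.2 ω - p))]

/-! ### The uniform law of large numbers -/

theorem lemma1 {Ω : Type*} [MeasurableSpace Ω] (P : Measure Ω) [IsProbabilityMeasure P] {d : ℕ}
    -- the data, observed for `i < N`, `j < M`
    (W : ℕ → ℕ → Ω → EuclideanSpace ℝ (Fin d))
    (hW : ∀ i j, Measurable (W i j))
    (hexch : SeparatelyExchangeable P W)
    (hdiss : Dissociated P W)
    -- the function class and its integrable envelope
    (𝓕 : Set (EuclideanSpace ℝ (Fin d) → ℝ))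
    (F : EuclideanSpace ℝ (Fin d) → ℝ)
    (henv : IsEnvelope 𝓕 F)
    (hFint : Integrable F (P.map (W 0 0)))
    (hcov : FiniteUniformCovering 𝓕 F)
    (hpm : PointwiseMeasurable 𝓕)
    -- the subsampling scheme for each sample size `(N, M)`
    (p : ℕ → ℕ → unitInterval)
    (hp : Tendsto (fun NM : ℕ × ℕ => (NM.1 : ℝ) * NM.2 * (p NM.1 NM.2 : ℝ))
      (comap (fun NM : ℕ × ℕ => min NM.1 NM.2) atTop) atTop)
    (Z : (N M : ℕ) → Fin N → Fin M → Ω → ℝ)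
    (hZ : ∀ N M, IsBernoulliSelection P W N M (p N M) (Z N M)) :
    ∀ δ : ℝ, 0 < δ →
      Tendsto (fun NM : ℕ × ℕ => P {ω | ENNReal.ofReal δ <
          ⨆ f ∈ 𝓕, ENNReal.ofReal
            |subsampleMean W (Z NM.1 NM.2) f ω - ∫ ω', f (W 0 0 ω') ∂P|})
        (comap (fun NM : ℕ × ℕ => min NM.1 NM.2) atTop) (𝓝 0) := by
  intro δ hδ
  obtain ⟨hmeas𝓕, 𝓖, h𝓖, hcount, hlim⟩ := hpm
  have hm : ∀ g ∈ 𝓖, Measurable g := fun g hg => hmeas𝓕 g (h𝓖 hg)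
  have : Countable 𝓖 := hcount
  set μ := P.map (W 0 0) with hμ
  have : IsProbabilityMeasure μ := Measure.isProbabilityMeasure_map (hW 0 0).aemeasurable
  have hint : ∀ g ∈ 𝓖, Integrable g μ := fun g hg =>
    hFint.mono (hm g hg).aestronglyMeasurable
      (ae_of_all _ fun x => (henv g (h𝓖 hg) x).trans (le_abs_self _))
  have hmap : ∀ g ∈ 𝓖, ∫ s, g s ∂μ = ∫ ω', g (W 0 0 ω') ∂P := fun g hg =>
    integral_map (hW 0 0).aemeasurable (hm g hg).aestronglyMeasurable
  set C : ℝ := ∫ x, |F x| ∂μ with hC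
  have hC0 : 0 ≤ C := integral_nonneg fun x => abs_nonneg _
  have hgC : ∀ g ∈ 𝓖, |∫ ω', g (W 0 0 ω') ∂P| ≤ C := fun g hg => by
    rw [← hmap g hg]
    exact (abs_integral_le_integral_abs).trans (integral_mono (hint g hg).abs hFint.abs
      fun x => (henv g (h𝓖 hg) x).trans (le_abs_self _))
  rw [ENNReal.tendsto_nhds_zero]
  intro η hη
  -- `η` may be infinite, so a finite positive `e` below it serves as the target.
  obtain ⟨e, he0, heη⟩ := ENNReal.lt_iff_exists_nnreal_btwn.1 hη
  have he : (0 : ℝ) < e := by exact_mod_cast he0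
  set κ : ℝ := min (δ / 2) (1 / 2)
  have hκ : 0 < κ := lt_min (by positivity) (by norm_num)
  -- The three terms contribute `6 * θ * n` times `1`, `1` and `C + 1`; dividing by `κ * n` in
  -- Markov's inequality leaves exactly `e`.
  set θ : ℝ := e * κ / (6 * (C + 3)) with hθ_def
  have hθ : 0 < θ := by positivity
  obtain ⟨n₁, hn₁, B, hBm, hBθ, hB⟩ :=
    exists_rademacher_bound henv hFint hcov h𝓖 hcount hm hθ
  obtain ⟨n₂, hn₂, B', hBm', hBθ', hB'⟩ := exists_rademacher_bound (μ := μ)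
    (𝓕 := {fun _ => (1 : ℝ)}) (F := fun _ => 1) (by rintro f rfl s; simp) (integrable_const _)
    (finiteUniformCovering_singleton _ _) subset_rfl (Set.countable_singleton _)
    (by rintro g rfl; exact measurable_const) hθ
  have hmin : Tendsto (fun NM : ℕ × ℕ => min NM.1 NM.2)
    (comap (fun NM : ℕ × ℕ => min NM.1 NM.2) atTop) atTop := tendsto_comap
  -- The sampling terms need the expected subsample size to be large; the array term needs the
  -- diagonal length `min N M` to be large.
  filter_upwards [hp.eventually_ge_atTop (max n₁ n₂), hmin.eventually_ge_atTop ⌈n₁⌉₊]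
    with ⟨N, M⟩ hNM hmn
  simp only at hNM hmn ⊢
  set q := p N M
  have hq0 : (0 : ℝ) ≤ q := q.2.1
  set m := min N M with hm_def
  have hmn₁ : n₁ ≤ m := (Nat.le_ceil _).trans (by exact_mod_cast hmn)
  have hm0 : 0 < m := by
    have : (0 : ℝ) < m := hn₁.trans_le hmn₁
    exact_mod_cast this
  have hcard : (q : ℝ) * Fintype.card (Fin N × Fin M) = N * M * q := by
    simp only [Fintype.card_prod, Fintype.card_fin, Nat.cast_mul]
    ring
  set n : ℝ := (q : ℝ) * Fintype.card (Fin N × Fin M) with hn_def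
  have hnn₁ : n₁ ≤ n := by rw [hcard]; exact (le_max_left _ _).trans hNM
  have hnn₂ : n₂ ≤ n := by rw [hcard]; exact (le_max_right _ _).trans hNM
  have hn : 0 < n := hn₁.trans_le hnn₁
  have hZ' := hZ N M
  set V : Ω → ℝ≥0∞ := fun ω => ‖∑ ij : Fin N × Fin M, (Z N M ij.1 ij.2 ω - q)‖ₑ with hV
  set U₁ : Ω → ℝ≥0∞ := fun ω => ⨆ g : 𝓖, ‖∑ ij : Fin N × Fin M,
    (Z N M ij.1 ij.2 ω * g.1 (W ij.1 ij.2 ω) - q * g.1 (W ij.1 ij.2 ω))‖ₑ with hU₁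
  set U₂ : Ω → ℝ≥0∞ := fun ω => ⨆ g : 𝓖, ‖∑ ij : Fin N × Fin M,
    (g.1 (W ij.1 ij.2 ω) - ∫ ω', g.1 (W 0 0 ω') ∂P)‖ₑ with hU₂
  obtain ⟨hU₁m, hU₁le⟩ : AEMeasurable U₁ P ∧ ∫⁻ ω, U₁ ω ∂P ≤ ENNReal.ofReal (6 * θ * n) :=
    lintegral_iSup_sampling_le (W := fun ij : Fin N × Fin M => W ij.1 ij.2)
      (Z := fun ij : Fin N × Fin M => Z N M ij.1 ij.2) hcount hm hBm hθ hBθ q hn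
      (hB n hnn₁ _) (fun ij => hW _ _) (fun ij => hexch.map_eq _ _) (fun ij => hZ'.hasLaw _ _)
      hZ'.iIndep hZ'.indep_data
  obtain ⟨hVm, hVle⟩ : AEMeasurable V P ∧ ∫⁻ ω, V ω ∂P ≤ ENNReal.ofReal (6 * θ * n) := by
    have := lintegral_iSup_sampling_le (W := fun ij : Fin N × Fin M => W ij.1 ij.2)
      (Z := fun ij : Fin N × Fin M => Z N M ij.1 ij.2) (Set.countable_singleton _)
      (by rintro g rfl; exact measurable_const) hBm' hθ hBθ' q hn
      (hB' n hnn₂ _) (fun ij => hW _ _) (fun ij => hexch.map_eq _ _) (fun ij => hZ'.hasLaw _ _)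
      hZ'.iIndep hZ'.indep_data
    simpa only [iSup_unique, Set.default_coe_singleton, mul_one] using this
  obtain ⟨hU₂m, hU₂le⟩ : AEMeasurable U₂ P ∧
      ∫⁻ ω, U₂ ω ∂P ≤ ENNReal.ofReal (6 * θ * (N * M)) := by
    have := lintegral_iSup_array_le hW hexch hdiss hcount hm hint hBm hθ hBθ hm0
      (min_le_left N M) (min_le_right N M) (hB m hmn₁ _)
    have hU₂' : U₂ = fun ω => ⨆ g : 𝓖, ‖∑ ij : Fin N × Fin M,
        (g.1 (W ij.1 ij.2 ω) - ∫ s, g.1 s ∂μ)‖ₑ := by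
      ext ω
      simp only [hU₂, fun g : 𝓖 => hmap g.1 g.2]
    rw [hU₂']
    exact this
  set T : Ω → ℝ≥0∞ := fun ω => U₁ ω + ENNReal.ofReal q * U₂ ω + ENNReal.ofReal (C + 1) * V ω
    with hT
  have hTm : AEMeasurable T P := (hU₁m.add (hU₂m.const_mul _)).add (hVm.const_mul _)
  have hTle : ∫⁻ ω, T ω ∂P ≤ ENNReal.ofReal (6 * θ * (C + 3) * n) := by
    simp only [hT]
    rw [lintegral_add_right' _ (hVm.const_mul _), lintegral_add_right' _ (hU₂m.const_mul _),
      lintegral_const_mul'' _ hU₂m, lintegral_const_mul'' _ hVm]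
    calc _ ≤ ENNReal.ofReal (6 * θ * n)
          + ENNReal.ofReal q * ENNReal.ofReal (6 * θ * (N * M))
          + ENNReal.ofReal (C + 1) * ENNReal.ofReal (6 * θ * n) := by gcongr
      _ = _ := by
        rw [← ENNReal.ofReal_mul hq0, ← ENNReal.ofReal_mul (by positivity),
          ← ENNReal.ofReal_add (by positivity) (by positivity),
          ← ENNReal.ofReal_add (by positivity) (by positivity)]
        congr 1
        rw [hcard]; ring
  -- Measurability of the event is not required: monotonicity of `P` moves the estimate to `T`,
  -- which is a.e. measurable.
  have hsub : {ω | ENNReal.ofReal δ <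
      ⨆ f ∈ 𝓕, ENNReal.ofReal |subsampleMean W (Z N M) f ω - ∫ ω', f (W 0 0 ω') ∂P|}
      ⊆ {ω | ENNReal.ofReal (κ * n) ≤ T ω} := fun ω hω =>
    le_of_ofReal_lt_iSup_subsample_error hgC W (Z N M) hq0 hn hδ hC0 (min_le_left _ _)
      (min_le_right _ _) ω (lt_of_lt_of_le hω
        (iSup_subsample_error_le (hW 0 0) henv hFint h𝓖 hm hlim W (Z N M) ω))
  have hκn : 0 < κ * n := by positivity
  calc _ ≤ P {ω | ENNReal.ofReal (κ * n) ≤ T ω} := measure_mono hsub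
    _ ≤ (∫⁻ ω, T ω ∂P) / ENNReal.ofReal (κ * n) :=
        meas_ge_le_lintegral_div hTm (ENNReal.ofReal_pos.2 hκn).ne' ENNReal.ofReal_ne_top
    _ ≤ ENNReal.ofReal (6 * θ * (C + 3) * n) / ENNReal.ofReal (κ * n) := by gcongr
    _ = e := by
        rw [← ENNReal.ofReal_div_of_pos hκn, ← ENNReal.ofReal_coe_nnreal]
        congr 1
        rw [hθ_def]
        field_simp
    _ ≤ η := heη.le
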